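/- Work in affine continuous logic. A Lipschitz language $L$ consists of constant symbols and of function and relation symbols of arity at least $1$, each function symbol $F$ and relation symbol $R$ carrying a Lipschitz constant $\lambda_F,\lambda_R\ge 0$. An $L$-structure is a nonempty complete metric space $(M,d)$ of diameter at most $1$ with elements $c^M$, $\lambda_F$-Lipschitz functions $F^M:M^k\to M$ and $\lambda_R$-Lipschitz functions $R^M:M^k\to[0,1]$, where $M^k$ carries the metric $d(\bar x,\bar y)=\sum_i d(x_i,y_i)$. Formulas are built from $1$, $d(t_1,t_2)$ and $R(t_1,\dots,t_k)$ ($t_i$ terms) by addition, multiplication by real numbers, and the quantifiers $\inf_x,\sup_x$, and are interpreted in $M$ as real-valued functions. A theory is a set of conditions $\sigma\le\tau$ between sentences; it is complete if it is satisfiable and every sentence has the same value in all of its models. For $A\subseteq M$ let $\mathbb D_n(A)$ be the ordered vector space of functions $\phi^M:M^n\to\mathbb R$, where $\phi(x_1,\dots,x_n)$ is a formula with parameters in $A$, and let $K_n(A)$ be the convex set of positive linear functionals $p:\mathbb D_n(A)\to\mathbb R$ with $p(1)=1$. A tuple $\bar a\in M^n$ realizes $p$ if $p(\phi^M)=\phi^M(\bar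 a)$ for all $\phi$. The structure $M$ is extremally $\aleph_0$-saturated if for every finite $A\subseteq M$ and every $n$, every extreme point of $K_n(A)$ is realized in $M$. A bounded uniformly continuous function $P:M^n\to\mathbb R$ is a definable predicate if it is a uniform limit on $M^n$ of functions $\phi_k^M$, where the $\phi_k$ are formulas without parameters. A nonempty set $D\subseteq M^n$ is definable if it is closed and $d(\bar x,D)=\inf_{\bar a\in D}d(\bar x,\bar a)$ is a definable predicate. **Theorem.** Let $T$ be a complete theory in a Lipschitz language which has a compact model, and let $M\models T$ be extremally $\aleph_0$-saturated. Then a nonempty set $D\subseteq M^n$ is definable if and only if there is a definable predicate $P:M^n\to[0,\infty)$ such that $D=\{\bar x\in M^n: P(\bar x)=0\}$. -/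

import Mathlib

open scoped NNReal Cardinal
open Filter

universe u v w

namespace AffineLogic

/-- A Lipschitz language: constant symbols, and function and relation symbols of arity at least one,
each of the latter two with a Lipschitz constant. The metric symbol is treated as a logical symbol. -/
structure Language where
  Const : Type u
  Fn : Type v
  Rel : Type v
  fnArity : Fn → ℕ
  relArity : Rel → ℕ
  fnArity_pos : ∀ F, 1 ≤ fnArity F
  relArity_pos : ∀ R, 1 ≤ relArity R
  fnLip : Fn → ℝ≥0
  relLip : Rel → ℝ≥0

/-- The metric `∑ i, d (x i) (y i)` on `M ^ n`. -/
noncomputable def tupleDist {M : Type w} [MetricSpace M] {n : ℕ} (x y : Fin n → M) : ℝ :=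
  ∑ i, dist (x i) (y i)

/-- The data making a metric space an `L`-structure: the metric is complete of diameter at most one,
functions and relations satisfy the Lipschitz condition prescribed by `L` for the metric `tupleDist`,
and relations take values in `[0, 1]`. -/
class Language.Structure (L : Language.{u, v}) (M : Type w) [MetricSpace M] where
  nonempty : Nonempty M
  complete : CompleteSpace M
  dist_le_one : ∀ a b : M, dist a b ≤ 1
  const : L.Const → M
  fn : ∀ F : L.Fn, (Fin (L.fnArity F) → M) → M
  rel : ∀ R : L.Rel, (Fin (L.relArity R) → M) → ℝ
  fn_lipschitz : ∀ F a b, dist (fn F a) (fn F b) ≤ L.fnLip F * tupleDist a b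
  rel_mem : ∀ R a, rel R a ∈ Set.Icc (0 : ℝ) 1
  rel_lipschitz : ∀ R a b, rel R a - rel R b ≤ L.relLip R * tupleDist a b

/-- Terms with free variables among `x₀, …, xₙ₋₁`. -/
inductive Term (L : Language.{u, v}) (n : ℕ) : Type (max u v)
  | var (i : Fin n) : Term L n
  | const (c : L.Const) : Term L n
  | app (F : L.Fn) (t : Fin (L.fnArity F) → Term L n) : Term L n

/-- Affine formulas with free variables among `x₀, …, xₙ₋₁`. The quantifiers bind the last variable. -/
inductive Formula (L : Language.{u, v}) : ℕ → Type (max u v)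
  | one {n : ℕ} : Formula L n
  | dist {n : ℕ} (s t : Term L n) : Formula L n
  | rel {n : ℕ} (R : L.Rel) (t : Fin (L.relArity R) → Term L n) : Formula L n
  | add {n : ℕ} (φ ψ : Formula L n) : Formula L n
  | smul {n : ℕ} (r : ℝ) (φ : Formula L n) : Formula L n
  | inf {n : ℕ} (φ : Formula L (n + 1)) : Formula L n
  | sup {n : ℕ} (φ : Formula L (n + 1)) : Formula L n

section Semantics

variable {L : Language.{u, v}} {M : Type w} [MetricSpace M] [S : L.Structure M]

/-- The value `t^M(x)` of a term. -/
def Term.eval {n : ℕ} (x : Fin n → M) : Term L n → M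
  | .var i => x i
  | .const c => S.const c
  | .app F t => S.fn F (fun i => (t i).eval x)

/-- The value `φ^M(x)` of a formula. -/
noncomputable def Formula.eval : {n : ℕ} → Formula L n → (Fin n → M) → ℝ
  | _, .one, _ => 1
  | _, .dist s t, x => Dist.dist (s.eval x) (t.eval x)
  | _, .rel R t, x => S.rel R (fun i => (t i).eval x)
  | _, .add φ ψ, x => φ.eval x + ψ.eval x
  | _, .smul r φ, x => r * φ.eval x
  | _, .inf φ, x => ⨅ b : M, φ.eval (Fin.snoc (α := fun _ => M) x b)
  | _, .sup φ, x => ⨆ b : M, φ.eval (Fin.snoc (α := fun _ => M) x b)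

end Semantics

/-- A sentence is a formula without free variables. -/
abbrev Sentence (L : Language.{u, v}) := Formula L 0

/-- The value of a sentence in `M`. -/
noncomputable def Sentence.value {L : Language.{u, v}} (σ : Sentence L)
    (M : Type w) [MetricSpace M] [L.Structure M] : ℝ :=
  Formula.eval σ (Fin.elim0 : Fin 0 → M)

/-- A theory is a set of closed conditions `σ ≤ τ`, coded as pairs `(σ, τ)`. -/
abbrev Theory (L : Language.{u, v}) := Set (Sentence L × Sentence L)

/-- `M ⊨ T`. -/
def Models {L : Language.{u, v}} (M : Type w) [MetricSpace M] [L.Structure M]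
    (T : Theory L) : Prop :=
  ∀ c ∈ T, Sentence.value c.1 M ≤ Sentence.value c.2 M

/-- `T` is complete: it is satisfiable, and for every sentence `σ` there is a real `r` such that
`T ⊨ σ = r`. Models are taken in the universe of the structures under consideration. -/
def Theory.IsComplete {L : Language.{u, v}} (T : Theory L) : Prop :=
  (∃ (N : Type w) (_ : MetricSpace N) (_ : L.Structure N), Models N T) ∧
  ∀ σ : Sentence L, ∃ r : ℝ, ∀ (N : Type w) [MetricSpace N] [L.Structure N],
    Models N T → Sentence.value σ N = r

/-- `T` has a compact model. -/
def Theory.HasCompactModel {L : Language.{u, v}} (T : Theory L) : Prop :=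
  ∃ (K : Type w) (_ : MetricSpace K) (_ : L.Structure K), CompactSpace K ∧ Models K T

/-- The language `L(A)`: a new constant symbol is added for every element of `A`. -/
def Language.withParams (L : Language.{u, v}) {M : Type w} (A : Set M) :
    Language.{max u w, v} where
  Const := L.Const ⊕ A
  Fn := L.Fn
  Rel := L.Rel
  fnArity := L.fnArity
  relArity := L.relArity
  fnArity_pos := L.fnArity_pos
  relArity_pos := L.relArity_pos
  fnLip := L.fnLip
  relLip := L.relLip

/-- The structure `(M, a)_{a ∈ A}`: the constant symbol for `a` is interpreted by `a`. -/
instance paramStructure (L : Language.{u, v}) {M : Type w} [MetricSpace M] [S : L.Structure M]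
    (A : Set M) : (L.withParams A).Structure M where
  nonempty := S.nonempty
  complete := S.complete
  dist_le_one := S.dist_le_one
  const := Sum.elim S.const Subtype.val
  fn := S.fn
  rel := S.rel
  fn_lipschitz := S.fn_lipschitz
  rel_mem := S.rel_mem
  rel_lipschitz := S.rel_lipschitz

/-- The vector space of formulas in `n` free variables, where two formulas are identified when they
have the same values in `M`; a class is represented by the function `x ↦ φ^M(x)` on `M ^ n`. -/
noncomputable def formulaSpace (L : Language.{u, v}) (M : Type w) [MetricSpace M] [L.Structure M]
    (n : ℕ) : Submodule ℝ ((Fin n → M) → ℝ) where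
  carrier := Set.range fun φ : Formula L n => (φ.eval : (Fin n → M) → ℝ)
  zero_mem' := ⟨.smul 0 .one, by funext x; simp [Formula.eval]⟩
  add_mem' := by
    rintro _ _ ⟨φ, rfl⟩ ⟨ψ, rfl⟩
    exact ⟨.add φ ψ, by funext x; simp [Formula.eval]⟩
  smul_mem' := by
    rintro r _ ⟨φ, rfl⟩
    exact ⟨.smul r φ, by funext x; simp [Formula.eval]⟩

/-- The class of the formula `1`. -/
noncomputable def formulaOne (L : Language.{u, v}) (M : Type w) [MetricSpace M] [L.Structure M]
    (n : ℕ) : formulaSpace L M n :=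
  ⟨fun _ => 1, .one, by funext x; simp [Formula.eval]⟩

/-- The convex set of complete `n`-types of the theory of `M`: positive normalized linear functionals
on the space of formulas in `n` free variables. -/
def typeSpace (L : Language.{u, v}) (M : Type w) [MetricSpace M] [L.Structure M] (n : ℕ) :
    Set (formulaSpace L M n →ₗ[ℝ] ℝ) :=
  {p | (∀ f : formulaSpace L M n, (∀ x, 0 ≤ f.1 x) → 0 ≤ p f) ∧ p (formulaOne L M n) = 1}

/-- The tuple `a` realizes the type `p`. -/
def Realizes {L : Language.{u, v}} {M : Type w} [MetricSpace M] [L.Structure M] {n : ℕ}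
    (a : Fin n → M) (p : formulaSpace L M n →ₗ[ℝ] ℝ) : Prop :=
  ∀ f : formulaSpace L M n, p f = f.1 a

/-- `M` is extremally `κ`-saturated: every extreme type over a set of fewer than `κ` parameters is
realized in `M`. -/
def IsExtremallySaturated (L : Language.{u, v}) (M : Type w) [MetricSpace M] [L.Structure M]
    (κ : Cardinal.{w}) : Prop :=
  ∀ A : Set M, #A < κ → ∀ n : ℕ, ∀ p ∈ (typeSpace (L.withParams A) M n).extremePoints ℝ,
    ∃ a : Fin n → M, Realizes a p

/-- A predicate on `M ^ n`: a bounded uniformly continuous real function. -/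
def IsPredicate {M : Type w} [MetricSpace M] {n : ℕ} (P : (Fin n → M) → ℝ) : Prop :=
  (∃ C : ℝ, ∀ x, |P x| ≤ C) ∧ UniformContinuous P

/-- A definable predicate (without parameters): a uniform limit on `M ^ n` of `L`-formulas. -/
def IsDefinablePredicate (L : Language.{u, v}) {M : Type w} [MetricSpace M] [L.Structure M]
    {n : ℕ} (P : (Fin n → M) → ℝ) : Prop :=
  IsPredicate P ∧
    ∃ φ : ℕ → Formula L n, TendstoUniformly (fun k x => (φ k).eval x) P atTop

/-- The distance `d(x, D)` of a point of `M ^ n` to a nonempty set `D`. -/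
noncomputable def distToSet {M : Type w} [MetricSpace M] {n : ℕ} (D : Set (Fin n → M))
    (x : Fin n → M) : ℝ :=
  ⨅ a : D, tupleDist x a

/-- A nonempty set `D` is definable (without parameters) if it is closed and `d(x, D)` is a definable
predicate. -/
def IsDefinableSet (L : Language.{u, v}) {M : Type w} [MetricSpace M] [L.Structure M]
    {n : ℕ} (D : Set (Fin n → M)) : Prop :=
  IsClosed D ∧ IsDefinablePredicate L (distToSet D)

end AffineLogic

namespace AffineLogic

section Substitution

variable {L : Language.{u, v}}

/-- Renaming of variables in a term. -/
def Term.rename {n m : ℕ} (ρ : Fin n → Fin m) : Term L n → Term L m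
  | .var i => .var (ρ i)
  | .const c => .const c
  | .app F t => .app F fun i => (t i).rename ρ

/-- Renaming of free variables in a formula. -/
def Formula.rename : {n m : ℕ} → (Fin n → Fin m) → Formula L n → Formula L m
  | _, _, _, .one => .one
  | _, _, ρ, .dist s t => .dist (s.rename ρ) (t.rename ρ)
  | _, _, ρ, .rel R t => .rel R fun i => (t i).rename ρ
  | _, _, ρ, .add φ ψ => .add (φ.rename ρ) (ψ.rename ρ)
  | _, _, ρ, .smul r φ => .smul r (φ.rename ρ)
  | _, m, ρ, .inf φ =>
      .inf (φ.rename (Fin.snoc (α := fun _ => Fin (m + 1)) (fun i => (ρ i).castSucc) (Fin.last m)))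
  | _, m, ρ, .sup φ =>
      .sup (φ.rename (Fin.snoc (α := fun _ => Fin (m + 1)) (fun i => (ρ i).castSucc) (Fin.last m)))

/-- A term of `L` as a term of `L(A)`. -/
def Term.withParams {M : Type w} (A : Set M) {n : ℕ} : Term L n → Term (L.withParams A) n
  | .var i => .var i
  | .const c => .const (Sum.inl c : L.Const ⊕ A)
  | .app F t => .app (L := L.withParams A) F fun i => (t i).withParams A

/-- A formula of `L` as a formula of `L(A)`. -/
def Formula.withParams {M : Type w} (A : Set M) :
    {n : ℕ} → Formula L n → Formula (L.withParams A) n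
  | _, .one => .one
  | _, .dist s t => .dist (s.withParams A) (t.withParams A)
  | _, .rel R t => .rel (L := L.withParams A) R fun i => (t i).withParams A
  | _, .add φ ψ => .add (φ.withParams A) (ψ.withParams A)
  | _, .smul r φ => .smul r (φ.withParams A)
  | _, .inf φ => .inf (φ.withParams A)
  | _, .sup φ => .sup (φ.withParams A)

/-- The formula `∑ i, d (s i) (t i)`. -/
def Formula.sumDist {n : ℕ} : {k : ℕ} → (Fin k → Term L n) → (Fin k → Term L n) → Formula L n
  | 0, _, _ => .smul 0 .one
  | _ + 1, s, t => .add (.dist (s 0) (t 0)) (sumDist (fun i => s i.succ) fun i => t i.succ)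

/-- The infimum over the last `k` variables. -/
def Formula.infs {n : ℕ} : (k : ℕ) → Formula L (n + k) → Formula L n
  | 0, φ => φ
  | k + 1, φ => infs k (.inf φ)

/-- The supremum over all variables. -/
def Formula.sups : {n : ℕ} → Formula L n → Sentence L
  | 0, φ => φ
  | _ + 1, φ => sups (.sup φ)

/-- The formula `inf_y (r φ(y) + d(x, y))`. -/
def Formula.infConv {n : ℕ} (r : ℝ) (φ : Formula L n) : Formula L n :=
  .infs n (.add (.smul r (φ.rename (Fin.natAdd n)))
    (.sumDist (fun i => .var (Fin.castAdd n i)) fun i => .var (Fin.natAdd n i)))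

end Substitution

section Semantics

variable {L : Language.{u, v}} {M : Type w} [MetricSpace M] [S : L.Structure M]

theorem Term.eval_rename {n m : ℕ} (ρ : Fin n → Fin m) (x : Fin m → M) (t : Term L n) :
    (t.rename ρ).eval x = t.eval (x ∘ ρ) := by
  induction t with
  | var i => rfl
  | const c => rfl
  | app F t ih => simp only [Term.rename, Term.eval, ih]

theorem Formula.eval_rename {n m : ℕ} (ρ : Fin n → Fin m) (x : Fin m → M) (φ : Formula L n) :
    (φ.rename ρ).eval x = φ.eval (x ∘ ρ) := by
  have key : ∀ {n m : ℕ} (ρ : Fin n → Fin m) (x : Fin m → M) (b : M),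
      Fin.snoc (α := fun _ => M) x b ∘
        Fin.snoc (α := fun _ => Fin (m + 1)) (fun i => (ρ i).castSucc) (Fin.last m) =
      Fin.snoc (α := fun _ => M) (x ∘ ρ) b := by
    intro n m ρ x b
    funext i
    refine Fin.lastCases ?_ (fun i => ?_) i <;> simp
  induction φ generalizing m with
  | one => rfl
  | dist s t => simp only [Formula.rename, Formula.eval, Term.eval_rename]
  | rel R t => simp only [Formula.rename, Formula.eval, Term.eval_rename]
  | add φ ψ h₁ h₂ => simp only [Formula.rename, Formula.eval, h₁, h₂]
  | smul r φ h => simp only [Formula.rename, Formula.eval, h]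
  | inf φ h => simp only [Formula.rename, Formula.eval, h, key]
  | sup φ h => simp only [Formula.rename, Formula.eval, h, key]

theorem Term.eval_withParams (A : Set M) {n : ℕ} (x : Fin n → M) (t : Term L n) :
    (t.withParams A).eval x = t.eval x := by
  induction t with
  | var i => rfl
  | const c => rfl
  | app F t ih => exact congrArg (S.fn F) (funext ih)

theorem Formula.eval_withParams (A : Set M) {n : ℕ} (x : Fin n → M) (φ : Formula L n) :
    (φ.withParams A).eval x = φ.eval x := by
  induction φ with
  | one => rfl
  | dist s t => simp only [Formula.withParams, Formula.eval, Term.eval_withParams]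
  | rel R t => simp only [Formula.withParams, Formula.eval, Term.eval_withParams]; rfl
  | add φ ψ h₁ h₂ => simp only [Formula.withParams, Formula.eval, h₁, h₂]
  | smul r φ h => simp only [Formula.withParams, Formula.eval, h]
  | inf φ h => simp only [Formula.withParams, Formula.eval, h]
  | sup φ h => simp only [Formula.withParams, Formula.eval, h]

theorem Formula.exists_abs_eval_le {n : ℕ} (φ : Formula L n) :
    ∃ C : ℝ, ∀ x : Fin n → M, |φ.eval x| ≤ C := by
  have : Nonempty M := S.nonempty
  induction φ with
  | one => exact ⟨1, fun x => by simp [Formula.eval]⟩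
  | dist s t =>
    exact ⟨1, fun x => by
      simpa only [Formula.eval, abs_of_nonneg dist_nonneg] using S.dist_le_one _ _⟩
  | rel R t =>
    exact ⟨1, fun x => by
      simpa only [Formula.eval, abs_of_nonneg (S.rel_mem R _).1] using (S.rel_mem R _).2⟩
  | add φ ψ h₁ h₂ =>
    obtain ⟨C, hC⟩ := h₁
    obtain ⟨D, hD⟩ := h₂
    exact ⟨C + D, fun x => (abs_add_le _ _).trans (add_le_add (hC x) (hD x))⟩
  | smul r φ h =>
    obtain ⟨C, hC⟩ := h
    exact ⟨|r| * C, fun x => by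
      simpa only [Formula.eval, abs_mul] using mul_le_mul_of_nonneg_left (hC x) (abs_nonneg r)⟩
  | inf φ h =>
    obtain ⟨C, hC⟩ := h
    refine ⟨C, fun x => abs_le.2 ⟨le_ciInf fun b => (abs_le.1 (hC _)).1, ?_⟩⟩
    exact (ciInf_le ⟨-C, Set.forall_mem_range.2 fun b => (abs_le.1 (hC _)).1⟩
      (Classical.arbitrary M)).trans (abs_le.1 (hC _)).2
  | sup φ h =>
    obtain ⟨C, hC⟩ := h
    refine ⟨C, fun x => abs_le.2 ⟨?_, ciSup_le fun b => (abs_le.1 (hC _)).2⟩⟩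
    exact (abs_le.1 (hC _)).1.trans (le_ciSup
      (f := fun b : M => φ.eval (Fin.snoc (α := fun _ => M) x b))
      ⟨C, Set.forall_mem_range.2 fun b => (abs_le.1 (hC _)).2⟩ (Classical.arbitrary M))

theorem Formula.le_eval_inf {n : ℕ} (φ : Formula L (n + 1)) (x : Fin n → M) (r : ℝ) :
    r ≤ (Formula.inf φ).eval x ↔ ∀ b : M, r ≤ φ.eval (Fin.snoc (α := fun _ => M) x b) := by
  have : Nonempty M := S.nonempty
  obtain ⟨C, hC⟩ := φ.exists_abs_eval_le (M := M)
  exact le_ciInf_iff ⟨-C, Set.forall_mem_range.2 fun b => (abs_le.1 (hC _)).1⟩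

theorem Formula.eval_sup_le {n : ℕ} (φ : Formula L (n + 1)) (x : Fin n → M) (r : ℝ) :
    (Formula.sup φ).eval x ≤ r ↔ ∀ b : M, φ.eval (Fin.snoc (α := fun _ => M) x b) ≤ r := by
  have : Nonempty M := S.nonempty
  obtain ⟨C, hC⟩ := φ.exists_abs_eval_le (M := M)
  exact ciSup_le_iff ⟨C, Set.forall_mem_range.2 fun b => (abs_le.1 (hC _)).2⟩

theorem Formula.le_eval_infs {n k : ℕ} (φ : Formula L (n + k)) (x : Fin n → M) (r : ℝ) :
    r ≤ (φ.infs k).eval x ↔ ∀ y : Fin k → M, r ≤ φ.eval (Fin.append x y) := by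
  induction k with
  | zero =>
    simp only [Formula.infs, Unique.forall_iff]
    rw [show Fin.append x (default : Fin 0 → M) = x from by
      funext i; exact Fin.append_left x _ i]
  | succ k ih =>
    simp only [Formula.infs, ih, Formula.le_eval_inf]
    constructor
    · intro h y
      have := h (Fin.init y) (y (Fin.last k))
      rwa [← Fin.append_snoc, Fin.snoc_init_self] at this
    · intro h y b
      rw [← Fin.append_snoc]
      exact h _

theorem Formula.value_sups_le {n : ℕ} (φ : Formula L n) (r : ℝ) :
    Sentence.value φ.sups M ≤ r ↔ ∀ x : Fin n → M, φ.eval x ≤ r := by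
  induction n with
  | zero =>
    simp only [Unique.forall_iff]
    rw [Subsingleton.elim (default : Fin 0 → M) Fin.elim0]
    rfl
  | succ n ih =>
    simp only [Formula.sups, ih, Formula.eval_sup_le]
    constructor
    · intro h x
      have := h (Fin.init x) (x (Fin.last n))
      rwa [Fin.snoc_init_self] at this
    · exact fun h x b => h _

theorem Formula.eval_sumDist {n k : ℕ} (s t : Fin k → Term L n) (x : Fin n → M) :
    (Formula.sumDist s t).eval x = tupleDist (fun i => (s i).eval x) fun i => (t i).eval x := by
  induction k with
  | zero => simp [Formula.sumDist, Formula.eval, tupleDist]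
  | succ k ih =>
    simp only [Formula.sumDist, Formula.eval, ih]
    simp only [tupleDist, Fin.sum_univ_succ]

theorem Formula.le_eval_infConv {n : ℕ} (c : ℝ) (φ : Formula L n) (x : Fin n → M) (r : ℝ) :
    r ≤ (φ.infConv c).eval x ↔ ∀ y : Fin n → M, r ≤ c * φ.eval y + tupleDist x y := by
  have h : ∀ y : Fin n → M, Fin.append x y ∘ Fin.natAdd n = y := fun y => by
    funext i; exact Fin.append_right x y i
  simp [-Fin.natAdd_eq_addNat, Formula.infConv, Formula.le_eval_infs, Formula.eval, Formula.eval_rename,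
    Formula.eval_sumDist, Term.eval, h]

theorem Formula.eval_infConv_le {n : ℕ} (c : ℝ) (φ : Formula L n) (x y : Fin n → M) :
    (φ.infConv c).eval x ≤ c * φ.eval y + tupleDist x y :=
  (Formula.le_eval_infConv c φ x _).1 le_rfl y

theorem tupleDist_nonneg {n : ℕ} (x y : Fin n → M) : 0 ≤ tupleDist x y :=
  Finset.sum_nonneg fun _ _ => dist_nonneg

end Semantics

end AffineLogic

namespace AffineLogic

section Metric

variable {M : Type w} [MetricSpace M] {n : ℕ}

theorem tupleDist_triangle (x y z : Fin n → M) :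
    tupleDist x z ≤ tupleDist x y + tupleDist y z := by
  simp only [tupleDist, ← Finset.sum_add_distrib]
  exact Finset.sum_le_sum fun _ _ => dist_triangle _ _ _

theorem tupleDist_le_mul_dist (x y : Fin n → M) : tupleDist x y ≤ (n : ℝ≥0) * dist x y := by
  refine (Finset.sum_le_card_nsmul _ _ (dist x y) fun i _ => dist_le_pi_dist x y i).trans ?_
  simp

theorem tupleDist_self (x : Fin n → M) : tupleDist x x = 0 := by
  simp [tupleDist]

theorem dist_le_tupleDist (x y : Fin n → M) : dist x y ≤ tupleDist x y :=
  (dist_pi_le_iff (tupleDist_nonneg x y)).2 fun i =>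
    Finset.single_le_sum (f := fun i => dist (x i) (y i)) (fun _ _ => dist_nonneg)
      (Finset.mem_univ i)

theorem lipschitzWith_of_le_add_tupleDist {f : (Fin n → M) → ℝ}
    (h : ∀ x y, f x ≤ f y + tupleDist x y) : LipschitzWith n f :=
  LipschitzWith.of_le_add_mul _ fun x y =>
    (h x y).trans (add_le_add_right (tupleDist_le_mul_dist x y) _)

theorem distToSet_le {D : Set (Fin n → M)} (x : Fin n → M) {a : Fin n → M} (ha : a ∈ D) :
    distToSet D x ≤ tupleDist x a :=
  ciInf_le (f := fun a : D => tupleDist x a)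
    ⟨0, Set.forall_mem_range.2 fun _ => tupleDist_nonneg _ _⟩ ⟨a, ha⟩

theorem distToSet_nonneg (D : Set (Fin n → M)) (x : Fin n → M) : 0 ≤ distToSet D x :=
  Real.iInf_nonneg fun _ => tupleDist_nonneg _ _

theorem distToSet_le_add {D : Set (Fin n → M)} (hD : D.Nonempty) (x y : Fin n → M) :
    distToSet D x ≤ distToSet D y + tupleDist x y := by
  have : Nonempty D := hD.to_subtype
  rw [← sub_le_iff_le_add]
  refine le_ciInf fun a => ?_
  linarith [distToSet_le x a.2, tupleDist_triangle x y a]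

theorem distToSet_eq_zero_iff {D : Set (Fin n → M)} (hD : D.Nonempty) (hc : IsClosed D)
    (x : Fin n → M) : distToSet D x = 0 ↔ x ∈ D := by
  have : Nonempty D := hD.to_subtype
  refine ⟨fun h => ?_, fun h => le_antisymm ?_ (distToSet_nonneg D x)⟩
  · rw [← hc.closure_eq, Metric.mem_closure_iff]
    intro ε hε
    obtain ⟨a, ha⟩ := exists_lt_of_ciInf_lt (f := fun a : D => tupleDist x a) (h.trans_lt hε)
    exact ⟨a, a.2, (dist_le_tupleDist x a).trans_lt ha⟩
  · exact (distToSet_le x h).trans_eq (tupleDist_self x)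

theorem Language.Structure.tupleDist_le {L : Language.{u, v}} (S : L.Structure M)
    (x y : Fin n → M) : tupleDist x y ≤ n := by
  refine (Finset.sum_le_card_nsmul _ _ 1 fun i _ => S.dist_le_one (x i) (y i)).trans ?_
  simp

end Metric

section Types

variable {L : Language.{u, v}} {M : Type w} [MetricSpace M] [S : L.Structure M] {n : ℕ}

theorem exists_abs_le_of_mem_formulaSpace (f : formulaSpace L M n) :
    ∃ C : ℝ, ∀ x, |f.1 x| ≤ C := by
  obtain ⟨φ, hφ⟩ := f.2
  obtain ⟨C, hC⟩ := φ.exists_abs_eval_le (M := M)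
  exact ⟨C, fun x => by rw [← hφ]; exact hC x⟩

variable (L) in
/-- The type of a tuple. -/
noncomputable def typeOf (a : Fin n → M) : formulaSpace L M n →ₗ[ℝ] ℝ :=
  (LinearMap.proj a).comp (formulaSpace L M n).subtype

theorem typeOf_apply (a : Fin n → M) (f : formulaSpace L M n) : typeOf L a f = f.1 a := rfl

theorem typeOf_mem_typeSpace (a : Fin n → M) : typeOf L a ∈ typeSpace L M n :=
  ⟨fun _ h => h a, rfl⟩

theorem apply_le_apply_of_mem_typeSpace {p : formulaSpace L M n →ₗ[ℝ] ℝ}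
    (hp : p ∈ typeSpace L M n) {f g : formulaSpace L M n} (h : ∀ x, f.1 x ≤ g.1 x) :
    p f ≤ p g := by
  have := hp.1 (g - f) fun x => sub_nonneg.2 (h x)
  rwa [map_sub, sub_nonneg] at this

theorem apply_le_add_of_mem_typeSpace {p : formulaSpace L M n →ₗ[ℝ] ℝ}
    (hp : p ∈ typeSpace L M n) {f g : formulaSpace L M n} {c : ℝ}
    (h : ∀ x, f.1 x ≤ g.1 x + c) : p f ≤ p g + c := by
  have := apply_le_apply_of_mem_typeSpace hp (f := f) (g := g + c • formulaOne L M n)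
    fun x => by simpa [formulaOne] using h x
  simpa [hp.2] using this

theorem abs_apply_le_of_mem_typeSpace {p : formulaSpace L M n →ₗ[ℝ] ℝ}
    (hp : p ∈ typeSpace L M n) {f : formulaSpace L M n} {C : ℝ}
    (h : ∀ x, |f.1 x| ≤ C) : |p f| ≤ C := by
  rw [abs_le]
  constructor
  · have := apply_le_add_of_mem_typeSpace hp (f := 0) (g := f) (c := C) fun x => by
      have := (abs_le.1 (h x)).1
      simp only [ZeroMemClass.coe_zero, Pi.zero_apply]
      linarith
    rw [map_zero] at this
    linarith
  · simpa using apply_le_add_of_mem_typeSpace hp (f := f) (g := 0) (c := C) fun x => by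
      simpa using (abs_le.1 (h x)).2

variable (L M n) in
/-- The linear inclusion of the algebraic dual into the space of all real functions. -/
noncomputable def dualToFun : (formulaSpace L M n →ₗ[ℝ] ℝ) →ₗ[ℝ] (formulaSpace L M n → ℝ) where
  toFun p := p
  map_add' _ _ := rfl
  map_smul' _ _ := rfl

theorem dualToFun_injective : Function.Injective (dualToFun L M n) := DFunLike.coe_injective

theorem isCompact_dualToFun_image : IsCompact (dualToFun L M n '' typeSpace L M n) := by
  choose C hC using exists_abs_le_of_mem_formulaSpace (L := L) (M := M) (n := n)
  refine IsCompact.of_isClosed_subset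
    (isCompact_univ_pi fun f : formulaSpace L M n => isCompact_Icc (a := -C f) (b := C f)) ?_ ?_
  · have h : dualToFun L M n '' typeSpace L M n =
        {g | (∀ f₁ f₂, g (f₁ + f₂) = g f₁ + g f₂) ∧ (∀ (r : ℝ) f, g (r • f) = r * g f) ∧
          (∀ f : formulaSpace L M n, (∀ x, 0 ≤ f.1 x) → 0 ≤ g f) ∧
          g (formulaOne L M n) = 1} := by
      ext g
      constructor
      · rintro ⟨p, hp, rfl⟩
        exact ⟨map_add p, map_smul p, hp.1, hp.2⟩
      · rintro ⟨h₁, h₂, h₃, h₄⟩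
        exact ⟨{ toFun := g, map_add' := h₁, map_smul' := h₂ }, ⟨h₃, h₄⟩, rfl⟩
    rw [h]
    simp only [Set.ofPred_and, Set.ofPred_forall]
    refine IsClosed.inter ?_ (IsClosed.inter ?_ (IsClosed.inter ?_ ?_))
    · exact isClosed_iInter fun f₁ => isClosed_iInter fun f₂ =>
        isClosed_eq (by fun_prop) (by fun_prop)
    · exact isClosed_iInter fun r => isClosed_iInter fun f =>
        isClosed_eq (by fun_prop) (by fun_prop)
    · exact isClosed_iInter fun f => isClosed_iInter fun _ =>
        isClosed_le (by fun_prop) (by fun_prop)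
    · exact isClosed_eq (by fun_prop) (by fun_prop)
  · rintro _ ⟨p, hp, rfl⟩ f -
    exact abs_le.1 (abs_apply_le_of_mem_typeSpace hp (hC f))

theorem mem_extremePoints_of_dualToFun {p : formulaSpace L M n →ₗ[ℝ] ℝ}
    (hp : dualToFun L M n p ∈ (dualToFun L M n '' typeSpace L M n).extremePoints ℝ) :
    p ∈ (typeSpace L M n).extremePoints ℝ := by
  refine ⟨(dualToFun_injective.mem_set_image).1 hp.1, fun q hq r hr hqr => ?_⟩
  refine dualToFun_injective (hp.2 (Set.mem_image_of_mem _ hq) (Set.mem_image_of_mem _ hr) ?_)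
  obtain ⟨a, b, ha, hb, hab, rfl⟩ := hqr
  exact ⟨a, b, ha, hb, hab, by simp⟩

/-- If nonnegative formulas `θ k` converge uniformly and `(y j)` is a sequence of tuples which
approximately minimizes the limit, then some extreme type minimizes the limit and takes at `δ` a
value not exceeding the asymptotic values of `δ` along the sequence. -/
theorem exists_extreme_type {e : ℕ → ℝ} (he : Tendsto e atTop (nhds 0))
    (θ : ℕ → formulaSpace L M n) (hθ₀ : ∀ k x, 0 ≤ (θ k).1 x)
    (hθ : ∀ k l x, (θ k).1 x ≤ (θ l).1 x + e k) (δ : formulaSpace L M n) {q : ℝ} {r s : ℕ → ℝ}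
    (hr : Tendsto r atTop (nhds 0)) (hs : Tendsto s atTop (nhds q)) (y : ℕ → Fin n → M)
    (hy : ∀ k j, (θ k).1 (y j) ≤ e k + r j) (hy' : ∀ j, δ.1 (y j) ≤ s j) :
    ∃ p ∈ (typeSpace L M n).extremePoints ℝ, (∀ k, p (θ k) ≤ e k) ∧ p δ ≤ q := by
  set K := dualToFun L M n '' typeSpace L M n with hKdef
  have hK : IsCompact K := isCompact_dualToFun_image
  set F := K ∩ {g | ∀ k, g (θ k) ≤ e k} with hFdef
  have hF : IsCompact F := by
    refine hK.inter_right ?_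
    simp only [Set.ofPred_forall]
    exact isClosed_iInter fun k => isClosed_le (by fun_prop) (by fun_prop)
  have hFK : IsExtreme ℝ K F := by
    refine ⟨Set.inter_subset_left, ?_⟩
    rintro _ ⟨p₁, hp₁, rfl⟩ _ ⟨p₂, hp₂, rfl⟩ _ hg ⟨a, b, ha, hb, hab, rfl⟩
    refine ⟨Set.mem_image_of_mem _ hp₁, fun k => ?_⟩
    have h₁ : ∀ l, p₁ (θ l) ≤ e l / a := fun l => by
      have h₂ : a * p₁ (θ l) + b * p₂ (θ l) ≤ e l := hg.2 l
      have h₃ := mul_nonneg hb.le (hp₂.1 _ (hθ₀ l))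
      rw [le_div_iff₀ ha]
      linarith
    have h₂ : Tendsto (fun l => e l / a + e k) atTop (nhds (e k)) := by
      simpa using (he.div_const a).add_const (e k)
    exact ge_of_tendsto' h₂ fun l =>
      (apply_le_add_of_mem_typeSpace hp₁ (hθ k l)).trans (add_le_add_left (h₁ l) _)
  obtain ⟨g, hgF, hgδ⟩ : ∃ g ∈ F, g δ ≤ q := by
    have hle : (((hyperfilter ℕ).map fun j => dualToFun L M n (typeOf L (y j)) :
        Ultrafilter _) : Filter (formulaSpace L M n → ℝ)) ≤ 𝓟 K :=
      tendsto_principal.2 (Eventually.of_forall fun j =>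
        Set.mem_image_of_mem _ (typeOf_mem_typeSpace (y j)))
    obtain ⟨g, hg, hlim⟩ := isCompact_iff_ultrafilter_le_nhds.1 hK _ hle
    have hlim' : ∀ f : formulaSpace L M n,
        Tendsto (fun j => f.1 (y j)) (hyperfilter ℕ) (nhds (g f)) := fun f =>
      ((continuous_apply f).tendsto g).comp hlim
    have hat : (hyperfilter ℕ : Filter ℕ) ≤ atTop := Nat.hyperfilter_le_atTop
    refine ⟨g, ⟨hg, fun k => ?_⟩, ?_⟩
    · refine le_of_tendsto_of_tendsto' (hlim' (θ k)) ?_ (hy k)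
      simpa using (hr.mono_left hat).const_add (e k)
    · exact le_of_tendsto_of_tendsto' (hlim' δ) (hs.mono_left hat) hy'
  set G := {g ∈ F | ∀ h ∈ F, g δ ≤ h δ} with hGdef
  have hexp : IsExposed ℝ F G := fun _ =>
    ⟨-ContinuousLinearMap.proj (R := ℝ) (φ := fun _ => ℝ) δ, by
      simp [hGdef]⟩
  have hGne : G.Nonempty := by
    obtain ⟨g₀, hg₀, hmin⟩ := hF.exists_isMinOn ⟨g, hgF⟩ (continuous_apply δ).continuousOn
    exact ⟨g₀, hg₀, fun h hh => hmin hh⟩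
  obtain ⟨g₀, hg₀⟩ := (hexp.isCompact hF).extremePoints_nonempty hGne
  have hg₀K := (hFK.trans hexp.isExtreme).extremePoints_subset_extremePoints hg₀
  obtain ⟨p, -, rfl⟩ := hg₀K.1
  exact ⟨p, mem_extremePoints_of_dualToFun hg₀K, hg₀.1.1.2, (hg₀.1.2 g hgF).trans hgδ⟩

end Types

section Transfer

variable {L : Language.{u, v}} {n : ℕ}

theorem Theory.IsComplete.eval_le {T : Theory L} (hT : Theory.IsComplete.{u, v, w} T)
    {M N : Type w} [MetricSpace M] [L.Structure M] [MetricSpace N] [L.Structure N]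
    (hM : Models M T) (hN : Models N T) {φ : Formula L n} {r : ℝ}
    (h : ∀ x : Fin n → M, φ.eval x ≤ r) (x : Fin n → N) : φ.eval x ≤ r := by
  obtain ⟨c, hc⟩ := hT.2 φ.sups
  refine (Formula.value_sups_le φ r).1 ?_ x
  rw [hc N hN, ← hc M hM]
  exact (Formula.value_sups_le φ r).2 h

theorem Theory.IsComplete.eval_le_add {T : Theory L} (hT : Theory.IsComplete.{u, v, w} T)
    {M N : Type w} [MetricSpace M] [L.Structure M] [MetricSpace N] [L.Structure N]
    (hM : Models M T) (hN : Models N T) {φ ψ : Formula L n} {r : ℝ}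
    (h : ∀ x : Fin n → M, φ.eval x ≤ ψ.eval x + r) (x : Fin n → N) :
    φ.eval x ≤ ψ.eval x + r := by
  have := hT.eval_le hM hN (φ := .add φ (.smul (-1) ψ)) (r := r)
    (fun x => by simp only [Formula.eval]; linarith [h x]) x
  simp only [Formula.eval] at this
  linarith

theorem Formula.eval_infConv_le_add {M : Type w} [MetricSpace M] [L.Structure M] (c : ℝ)
    (φ : Formula L n) (x y : Fin n → M) :
    (φ.infConv c).eval x ≤ (φ.infConv c).eval y + tupleDist x y := by
  rw [← sub_le_iff_le_add, Formula.le_eval_infConv]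
  intro z
  linarith [Formula.eval_infConv_le c φ x z, tupleDist_triangle x y z]

end Transfer

section Definability

variable {L : Language.{u, v}} {n : ℕ} {M : Type w} [MetricSpace M] [S : L.Structure M]

theorem IsDefinablePredicate.exists_formula {P : (Fin n → M) → ℝ}
    (hP : IsDefinablePredicate L P) {ε : ℝ} (hε : 0 < ε) :
    ∃ φ : Formula L n, ∀ x, P x ≤ φ.eval x ∧ φ.eval x ≤ P x + ε := by
  obtain ⟨-, φ, hφ⟩ := hP
  obtain ⟨k, hk⟩ := (Metric.tendstoUniformly_iff.1 hφ (ε / 2) (half_pos hε)).exists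
  refine ⟨.add (φ k) (.smul (ε / 2) .one), fun x => ?_⟩
  have := abs_lt.1 ((Real.dist_eq _ _).symm.trans_lt (hk x))
  simp only [Formula.eval]
  constructor <;> linarith [this.1, this.2]

/-- A bounded monotone sequence of formulas which are uniformly Lipschitz in a compact model
converges uniformly there, hence is uniformly Cauchy in every model. -/
theorem Theory.IsComplete.exists_forall_eval_le_add {T : Theory L}
    (hT : Theory.IsComplete.{u, v, w} T) {K : Type w} [MetricSpace K] [L.Structure K]
    [CompactSpace K] (hK : Models K T) (hM : Models M T) {χ : ℕ → Formula L n}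
    (hmono : ∀ j (x : Fin n → M), (χ j).eval x ≤ (χ (j + 1)).eval x) {C : ℝ}
    (hC : ∀ j (x : Fin n → M), (χ j).eval x ≤ C)
    (hlip : ∀ j (x y : Fin n → K), (χ j).eval x ≤ (χ j).eval y + tupleDist x y)
    {ε : ℝ} (hε : 0 < ε) :
    ∃ m, ∀ j, ∀ x : Fin n → M, (χ j).eval x ≤ (χ m).eval x + ε := by
  have hmonoK : ∀ x : Fin n → K, Monotone fun j => (χ j).eval x := fun x =>
    monotone_nat_of_le_succ fun j => by
      simpa using hT.eval_le_add hM hK (φ := χ j) (ψ := χ (j + 1)) (r := 0)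
        (by simpa using hmono j) x
  have hCK : ∀ x : Fin n → K, BddAbove (Set.range fun j => (χ j).eval x) := fun x =>
    ⟨C, Set.forall_mem_range.2 fun j => hT.eval_le hM hK (hC j) x⟩
  have hcont : Continuous fun x : Fin n → K => ⨆ j, (χ j).eval x := by
    refine (lipschitzWith_of_le_add_tupleDist fun x y => ciSup_le fun j => ?_).continuous
    exact (hlip j x y).trans (add_le_add_left (le_ciSup (hCK y) j) _)
  have hunif : TendstoUniformly (fun j (x : Fin n → K) => (χ j).eval x)
      (fun x => ⨆ j, (χ j).eval x) atTop :=
    Monotone.tendstoUniformly_of_forall_tendsto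
      (fun j => (lipschitzWith_of_le_add_tupleDist (hlip j)).continuous)
      (fun _ _ h x => hmonoK x h) hcont fun x => tendsto_atTop_ciSup (hmonoK x) (hCK x)
  obtain ⟨m, hm⟩ := (Metric.tendstoUniformly_iff.1 hunif ε hε).exists
  refine ⟨m, fun j => hT.eval_le_add hK hM fun x => ?_⟩
  have := (abs_lt.1 ((Real.dist_eq _ _).symm.trans_lt (hm x))).2
  linarith [le_ciSup (hCK x) j]

theorem IsDefinableSet.exists_predicate {D : Set (Fin n → M)} (hD : D.Nonempty)
    (h : IsDefinableSet L D) :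
    ∃ P : (Fin n → M) → ℝ, IsDefinablePredicate L P ∧ (∀ x, 0 ≤ P x) ∧ D = {x | P x = 0} :=
  ⟨distToSet D, h.2, distToSet_nonneg D,
    Set.ext fun x => (distToSet_eq_zero_iff hD h.1 x).symm⟩

/-- In an extremally `ℵ₀`-saturated structure, if a sequence of tuples asymptotically lies in the
zero set of a nonnegative definable predicate and at distance `q` from `x`, then the zero set has a
point at distance at most `q` from `x`. -/
theorem IsExtremallySaturated.exists_zero (hsat : IsExtremallySaturated L M ℵ₀)
    {P : (Fin n → M) → ℝ} (hP : ∀ x, 0 ≤ P x) {e : ℕ → ℝ} (he : Tendsto e atTop (nhds 0))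
    {θ : ℕ → Formula L n} (hθ₁ : ∀ k x, P x ≤ (θ k).eval x)
    (hθ₂ : ∀ k x, (θ k).eval x ≤ P x + e k) (x : Fin n → M) {q : ℝ} {r s : ℕ → ℝ}
    (hr : Tendsto r atTop (nhds 0)) (hs : Tendsto s atTop (nhds q)) (y : ℕ → Fin n → M)
    (hy : ∀ j, P (y j) ≤ r j) (hy' : ∀ j, tupleDist x (y j) ≤ s j) :
    ∃ a, P a = 0 ∧ tupleDist x a ≤ q := by
  let A : Set M := Set.range x
  have hA : Cardinal.mk A < ℵ₀ := Cardinal.lt_aleph0_iff_set_finite.2 (Set.finite_range x)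
  let θ' : ℕ → formulaSpace (L.withParams A) M n := fun k =>
    ⟨fun z => (θ k).eval z, (θ k).withParams A, funext fun z => (θ k).eval_withParams A z⟩
  let δ : formulaSpace (L.withParams A) M n :=
    ⟨fun z => tupleDist x z,
      .sumDist (fun i => .const (Sum.inr ⟨x i, i, rfl⟩ : L.Const ⊕ A)) fun i => .var i,
      funext fun z => Formula.eval_sumDist _ _ z⟩
  obtain ⟨p, hp, hpθ, hpδ⟩ := exists_extreme_type he θ'
    (fun k z => (hP z).trans (hθ₁ k z))
    (fun k l z => (hθ₂ k z).trans (add_le_add_left (hθ₁ l z) _)) δ hr hs y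
    (fun k j => by
      have := hθ₂ k (y j)
      change (θ k).eval (y j) ≤ e k + r j
      linarith [hy j])
    hy'
  obtain ⟨a, ha⟩ := hsat A hA n p hp
  refine ⟨a, le_antisymm (ge_of_tendsto' he fun k => ?_) (hP a), (ha δ).symm.trans_le hpδ⟩
  exact (hθ₁ k a).trans ((ha (θ' k)).symm.trans_le (hpθ k))

theorem IsDefinablePredicate.isDefinableSet_zeros {T : Theory L}
    (hT : Theory.IsComplete.{u, v, w} T) (hK : Theory.HasCompactModel.{u, v, w} T)
    (hM : Models M T) (hsat : IsExtremallySaturated L M ℵ₀) {P : (Fin n → M) → ℝ}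
    (hP : IsDefinablePredicate L P) (hP₀ : ∀ x, 0 ≤ P x) (hne : {x | P x = 0}.Nonempty) :
    IsDefinableSet L {x | P x = 0} := by
  obtain ⟨K, _, _, _, hKT⟩ := hK
  set D := {x | P x = 0} with hDdef
  have hpos : ∀ j : ℕ, (0 : ℝ) < (1 / 4) ^ j := fun j => by positivity
  choose θ hθ using fun j => hP.exists_formula (hpos j)
  have hpow : ∀ j : ℕ, (2 : ℝ) ^ j * (1 / 4) ^ j = (1 / 2) ^ j := fun j => by
    rw [← mul_pow]; norm_num
  have hlim2 : Tendsto (fun j : ℕ => (1 / 2 : ℝ) ^ j) atTop (nhds 0) :=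
    tendsto_pow_atTop_nhds_zero_of_lt_one (by norm_num) (by norm_num)
  have hlim4 : Tendsto (fun j : ℕ => (1 / 4 : ℝ) ^ j) atTop (nhds 0) :=
    tendsto_pow_atTop_nhds_zero_of_lt_one (by norm_num) (by norm_num)
  have hup : ∀ j x, 2 ^ j * (θ j).eval x ≤ 2 ^ j * P x + (1 / 2) ^ j := fun j x => by
    rw [← hpow, ← mul_add]
    exact mul_le_mul_of_nonneg_left (hθ j x).2 (by positivity)
  have hlow : ∀ j x, 2 ^ j * P x ≤ 2 ^ j * (θ j).eval x := fun j x =>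
    mul_le_mul_of_nonneg_left (hθ j x).1 (by positivity)
  let χ : ℕ → Formula L n := fun j =>
    .add ((θ j).infConv (2 ^ j)) (.smul (-2 * (1 / 2) ^ j) .one)
  have hχ : ∀ {N : Type w} [MetricSpace N] [L.Structure N] (j : ℕ) (x : Fin n → N),
      (χ j).eval x = ((θ j).infConv (2 ^ j)).eval x - 2 * (1 / 2) ^ j := by
    intro N _ _ j x
    simp only [χ, Formula.eval]
    ring
  have hmono : ∀ j (x : Fin n → M), (χ j).eval x ≤ (χ (j + 1)).eval x := by
    intro j x
    have : ((θ j).infConv (2 ^ j)).eval x - (1 / 2) ^ j ≤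
        ((θ (j + 1)).infConv (2 ^ (j + 1))).eval x := by
      rw [Formula.le_eval_infConv]
      intro y
      have h₁ := Formula.eval_infConv_le (2 ^ j) (θ j) x y
      have h₂ := hup j y
      have h₃ := hlow (j + 1) y
      have h₄ : (2 : ℝ) ^ j * P y ≤ 2 ^ (j + 1) * P y := by
        rw [pow_succ]
        nlinarith [mul_nonneg (pow_nonneg zero_le_two j : (0 : ℝ) ≤ 2 ^ j) (hP₀ y)]
      linarith
    rw [hχ, hχ, pow_succ (1 / 2 : ℝ)]
    linarith
  have hdist : ∀ j (x : Fin n → M), (χ j).eval x ≤ distToSet D x := by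
    intro j x
    have : Nonempty D := hne.to_subtype
    refine le_ciInf fun a => ?_
    have h₁ := Formula.eval_infConv_le (2 ^ j) (θ j) x a
    have h₂ := hup j a
    have h₃ : P a = 0 := a.2
    have h₄ : (0 : ℝ) < (1 / 2) ^ j := by positivity
    rw [hχ]
    rw [h₃] at h₂
    linarith
  have hbound : ∀ x, distToSet D x ≤ n := fun x =>
    (distToSet_le x hne.choose_spec).trans (S.tupleDist_le _ _)
  have hattain : ∀ x, distToSet D x ≤ ⨆ j, (χ j).eval x := by
    intro x
    set q := ⨆ j, (χ j).eval x
    have hq : ∀ j, (χ j).eval x ≤ q := fun j =>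
      le_ciSup (f := fun j => (χ j).eval x)
        ⟨distToSet D x, Set.forall_mem_range.2 fun j => hdist j x⟩ j
    have hex : ∀ j : ℕ, ∃ y : Fin n → M,
        2 ^ j * (θ j).eval y + tupleDist x y < q + 3 * (1 / 2) ^ j := by
      intro j
      by_contra! h
      have h₁ := (Formula.le_eval_infConv _ _ _ _).2 h
      have h₂ := hq j
      have h₃ : (0 : ℝ) < (1 / 2) ^ j := by positivity
      rw [hχ] at h₂
      linarith
    choose y hy using hex
    obtain ⟨a, ha, hxa⟩ := hsat.exists_zero hP₀ hlim4 (fun k z => (hθ k z).1)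
      (fun k z => (hθ k z).2) x (q := q) (r := fun j => (q + 3 * (1 / 2) ^ j) * (1 / 2) ^ j)
      (s := fun j => q + 3 * (1 / 2) ^ j)
      (by simpa using ((hlim2.const_mul 3).const_add q).mul hlim2)
      (by simpa using (hlim2.const_mul 3).const_add q) y
      (fun j => by
        have h₁ := hy j
        have h₂ := hlow j (y j)
        have h₃ := tupleDist_nonneg x (y j)
        rw [one_div_pow, mul_one_div, le_div_iff₀ (by positivity)]
        rw [one_div_pow] at h₁
        linarith)
      (fun j => by
        have h₂ := hlow j (y j)
        have h₃ : 0 ≤ 2 ^ j * P (y j) := mul_nonneg (by positivity) (hP₀ _)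
        linarith [hy j])
    exact (distToSet_le x (show a ∈ D from ha)).trans hxa
  refine ⟨isClosed_eq hP.1.2.continuous continuous_const,
    ⟨⟨n, fun x => ?_⟩, ?_⟩, χ, Metric.tendstoUniformly_iff.2 fun ε hε => ?_⟩
  · rw [abs_of_nonneg (distToSet_nonneg D x)]
    exact hbound x
  · exact (lipschitzWith_of_le_add_tupleDist (distToSet_le_add hne)).uniformContinuous
  · obtain ⟨m, hm⟩ := hT.exists_forall_eval_le_add hKT hM hmono
      (fun j x => (hdist j x).trans (hbound x))
      (fun j x y => by
        rw [hχ, hχ]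
        linarith [Formula.eval_infConv_le_add (2 ^ j) (θ j) x y]) (half_pos hε)
    filter_upwards [eventually_ge_atTop m] with j hj x
    have h₁ : (χ m).eval x ≤ (χ j).eval x :=
      monotone_nat_of_le_succ (f := fun j => (χ j).eval x) (fun j => hmono j x) hj
    have h₂ : distToSet D x ≤ (χ m).eval x + ε / 2 :=
      (hattain x).trans (ciSup_le fun j => hm j x)
    rw [Real.dist_eq, abs_lt]
    constructor <;> linarith [hdist j x]

end Definability

end AffineLogic

theorem mainTheorem12 {L : AffineLogic.Language.{u, v}} (T : AffineLogic.Theory L)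
    (hT : AffineLogic.Theory.IsComplete.{u, v, w} T)
    (hK : AffineLogic.Theory.HasCompactModel.{u, v, w} T)
    (M : Type w) [MetricSpace M] [L.Structure M] (hM : AffineLogic.Models M T)
    (hsat : AffineLogic.IsExtremallySaturated L M Cardinal.aleph0)
    (n : ℕ) (D : Set (Fin n → M)) (hD : D.Nonempty) :
    AffineLogic.IsDefinableSet L D ↔
      ∃ P : (Fin n → M) → ℝ, AffineLogic.IsDefinablePredicate L P ∧
        (∀ x, 0 ≤ P x) ∧ D = {x | P x = 0} := by
  refine ⟨fun h => h.exists_predicate hD, ?_⟩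
  rintro ⟨P, hP, hP₀, rfl⟩
  exact hP.isDefinableSet_zeros hT hK hM hsat hP₀ hD
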